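/- Let $H$ be a complex Hilbert space and let $E\subset B(H)$ be an operator space, i.e. a closed linear subspace of $B(H)$. Let $\overline H$ be the conjugate Hilbert space of $H$, for $x\in B(H)$ let $\overline x\in B(\overline H)$ be the operator $\overline x\,\overline h=\overline{x h}$, and let $\overline E=\{\overline x : x\in E\}\subset B(\overline H)$ be the conjugate operator space. For operator spaces $E\subset B(H)$ and $F\subset B(K)$, let $E\otimes_{\min}F$ be the completion of the algebraic tensor product for the norm induced by $B(H\otimes K)$, where $H\otimes K$ is the Hilbert space tensor product; equivalently, the closed linear span in $B(H\otimes K)$ of the operators $x\otimes y$ with $x\in E$, $y\in F$. A bounded linear map $u:E\to F$ into a Banach space is called $(2,oh)$-summing if there is a constant $C\ge 0$ such that for every $n$ and all $x_1,\dots,x_n\in E$, $$\Big(\sum_{i=1}^n\|u(x_i)\|^2\Big)^{1/2}\le C\,\Big\|\sum_{i=1}^n x_i\otimes\overline{x_i}\Big\|^{1/2}_{E\otimes_{\min}\overline E},$$ and then $\pi_{2,oh}(u)$ denotes the smallest such $C$. Proposition. A bounded linear map $u:E\to\ell_2$ is $(2,oh)$-summing with $\pi_{2,oh}(u)\le 1$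 if and only if there is a continuous linear functional $v\in(E\otimes_{\min}\overline E)^*$ with norm $I(v)\le 1$ in this dual such that, for all $x\in E$, $v(x\otimes\overline x)\in\mathbb R$ and $$\|u(x)\|^2\le v(x\otimes\overline x).$$ -/

import Mathlib

open scoped TensorProduct InnerProductSpace

noncomputable section

/-! ### Conjugate Hilbert spaces -/

/-- The conjugate Hilbert space of `H`: the same additive group and norm, with scalar action
`c • (conjugate of h) = conjugate of (conj c • h)`. -/
def ConjSpace (H : Type*) : Type _ := H

namespace ConjSpace

variable {H : Type*} [NormedAddCommGroup H] [InnerProductSpace ℂ H]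

instance : NormedAddCommGroup (ConjSpace H) := inferInstanceAs (NormedAddCommGroup H)

instance : Module ℂ (ConjSpace H) := Module.compHom H (starRingEnd ℂ)

/-- The inner product of the conjugates of `h` and `k` is `⟪k, h⟫`. -/
instance : InnerProductSpace ℂ (ConjSpace H) where
  norm_smul_le c x := by
    have h := norm_smul_le ((starRingEnd ℂ) c) (show H from x)
    rw [RCLike.norm_conj] at h
    exact h
  inner x y := ⟪(show H from y), (show H from x)⟫_ℂ
  norm_sq_eq_re_inner x := norm_sq_eq_re_inner (𝕜 := ℂ) (show H from x)
  conj_inner_symm x y := inner_conj_symm (𝕜 := ℂ) (show H from y) (show H from x)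
  add_left x y z := inner_add_right (𝕜 := ℂ) (show H from z) (show H from x) (show H from y)
  smul_left x y c :=
    inner_smul_right (𝕜 := ℂ) (show H from y) (show H from x) ((starRingEnd ℂ) c)

instance [CompleteSpace H] : CompleteSpace (ConjSpace H) := inferInstanceAs (CompleteSpace H)

/-- The canonical antilinear isometry from `H` onto its conjugate. -/
def mk : H ≃ₗᵢ⋆[ℂ] ConjSpace H where
  toFun h := h
  invFun h := h
  map_add' _ _ := rfl
  map_smul' c h := by
    change c • h = (starRingEnd ℂ) ((starRingEnd ℂ) c) • h
    rw [Complex.conj_conj]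
  left_inv _ := rfl
  right_inv _ := rfl
  norm_map' _ := rfl

theorem inner_mk_mk (h k : H) : ⟪mk h, mk k⟫_ℂ = ⟪k, h⟫_ℂ := rfl

end ConjSpace

section Conjugation

variable {H : Type*} [NormedAddCommGroup H] [InnerProductSpace ℂ H]

/-- The antilinear map sending an operator `x` on `H` to the conjugate operator on the conjugate
space, which takes the conjugate of `h` to the conjugate of `x h`. -/
def conjOp : (H →L[ℂ] H) →ₛₗ[starRingEnd ℂ] (ConjSpace H →L[ℂ] ConjSpace H) where
  toFun x :=
    { toFun := fun h => ConjSpace.mk (x (ConjSpace.mk.symm h))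
      map_add' := fun h k => congrArg ConjSpace.mk
        (map_add x (ConjSpace.mk.symm h) (ConjSpace.mk.symm k))
      map_smul' := fun c h => congrArg ConjSpace.mk
        (map_smul x ((starRingEnd ℂ) c) (ConjSpace.mk.symm h))
      cont := ConjSpace.mk.continuous.comp (x.continuous.comp ConjSpace.mk.symm.continuous) }
  map_add' _ _ := rfl
  map_smul' c x := by
    ext h
    exact map_smulₛₗ (ConjSpace.mk (H := H)) c (x (ConjSpace.mk.symm h))

@[simp]
theorem conjOp_mk (x : H →L[ℂ] H) (h : H) : conjOp x (ConjSpace.mk h) = ConjSpace.mk (x h) := rfl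

/-- The conjugate operator space of a subspace `E` of `B(H)`: the subspace of the operators on the
conjugate Hilbert space that are conjugates of elements of `E`. -/
def conjOpSpace (E : Submodule ℂ (H →L[ℂ] H)) :
    Submodule ℂ (ConjSpace H →L[ℂ] ConjSpace H) :=
  E.map conjOp

/-- The conjugate of an element of `E`, as an element of the conjugate operator space. -/
def conjElt {E : Submodule ℂ (H →L[ℂ] H)} (x : E) : conjOpSpace E :=
  ⟨conjOp (x : H →L[ℂ] H), Submodule.mem_map_of_mem x.2⟩

end Conjugation

/-! ### The minimal tensor product -/

section MinTensor

variable {H K : Type*} [NormedAddCommGroup H] [InnerProductSpace ℂ H]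
  [NormedAddCommGroup K] [InnerProductSpace ℂ K]

/-- The Hilbert space tensor product of `H` and `K`: the completion of the algebraic tensor product
for the inner product determined by `⟪h ⊗ k, h' ⊗ k'⟫ = ⟪h, h'⟫ ⟪k, k'⟫`. -/
def HilbertTensor (H K : Type*) [NormedAddCommGroup H] [InnerProductSpace ℂ H]
    [NormedAddCommGroup K] [InnerProductSpace ℂ K] : Type _ :=
  UniformSpace.Completion (H ⊗[ℂ] K)

instance : NormedAddCommGroup (HilbertTensor H K) :=
  inferInstanceAs (NormedAddCommGroup (UniformSpace.Completion (H ⊗[ℂ] K)))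

instance : InnerProductSpace ℂ (HilbertTensor H K) :=
  inferInstanceAs (InnerProductSpace ℂ (UniformSpace.Completion (H ⊗[ℂ] K)))

instance : CompleteSpace (HilbertTensor H K) :=
  inferInstanceAs (CompleteSpace (UniformSpace.Completion (H ⊗[ℂ] K)))

/-- The canonical isometric inclusion of the algebraic tensor product. -/
def HilbertTensor.incl (H K : Type*) [NormedAddCommGroup H] [InnerProductSpace ℂ H]
    [NormedAddCommGroup K] [InnerProductSpace ℂ K] : H ⊗[ℂ] K →ₗᵢ[ℂ] HilbertTensor H K :=
  UniformSpace.Completion.toComplₗᵢ (𝕜 := ℂ) (E := H ⊗[ℂ] K)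

theorem HilbertTensor.denseRange_incl : DenseRange (HilbertTensor.incl H K) :=
  UniformSpace.Completion.denseRange_coe (α := H ⊗[ℂ] K)

/-- The operator `x ⊗ y` on the Hilbert space tensor product: the unique continuous extension of
the algebraic tensor product of `x` and `y`. -/
def opTensor (x : H →L[ℂ] H) (y : K →L[ℂ] K) : HilbertTensor H K →L[ℂ] HilbertTensor H K :=
  ((HilbertTensor.incl H K).toContinuousLinearMap.comp (TensorProduct.mapL x y)).extend
    (HilbertTensor.incl H K).toContinuousLinearMap

theorem opTensor_incl (x : H →L[ℂ] H) (y : K →L[ℂ] K) (t : H ⊗[ℂ] K) :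
    opTensor x y (HilbertTensor.incl H K t) = HilbertTensor.incl H K (TensorProduct.mapL x y t) := by
  have h := ContinuousLinearMap.extend_eq
    ((HilbertTensor.incl H K).toContinuousLinearMap.comp (TensorProduct.mapL x y))
    (e := (HilbertTensor.incl H K).toContinuousLinearMap)
    (by simpa using HilbertTensor.denseRange_incl)
    (by simpa using (HilbertTensor.incl H K).isometry.isUniformInducing) t
  simpa only [opTensor, ContinuousLinearMap.comp_apply,
    LinearIsometry.coe_toContinuousLinearMap] using h

theorem opTensor_incl_tmul (x : H →L[ℂ] H) (y : K →L[ℂ] K) (h : H) (k : K) :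
    opTensor x y (HilbertTensor.incl H K (h ⊗ₜ[ℂ] k)) =
      HilbertTensor.incl H K (x h ⊗ₜ[ℂ] y k) :=
  opTensor_incl x y _

/-- The subspace underlying the minimal (spatial) tensor product of `E ⊆ B(H)` and `F ⊆ B(K)`: the
closed linear span of the operators `x ⊗ y`, `x ∈ E`, `y ∈ F`, in the bounded operators on the
Hilbert space tensor product. -/
def minTensorSubmodule (E : Submodule ℂ (H →L[ℂ] H)) (F : Submodule ℂ (K →L[ℂ] K)) :
    Submodule ℂ (HilbertTensor H K →L[ℂ] HilbertTensor H K) :=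
  (Submodule.span ℂ {T | ∃ x ∈ E, ∃ y ∈ F, T = opTensor x y}).topologicalClosure

/-- The minimal tensor product of `E ⊆ B(H)` and `F ⊆ B(K)`, with the operator norm. -/
def MinTensor (E : Submodule ℂ (H →L[ℂ] H)) (F : Submodule ℂ (K →L[ℂ] K)) : Type _ :=
  minTensorSubmodule E F

instance (E : Submodule ℂ (H →L[ℂ] H)) (F : Submodule ℂ (K →L[ℂ] K)) :
    NormedAddCommGroup (MinTensor E F) :=
  Submodule.normedAddCommGroup (minTensorSubmodule E F)

instance (E : Submodule ℂ (H →L[ℂ] H)) (F : Submodule ℂ (K →L[ℂ] K)) :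
    NormedSpace ℂ (MinTensor E F) :=
  Submodule.normedSpace (minTensorSubmodule E F)

/-- The inclusion of the minimal tensor product in the operators on the Hilbert space tensor
product. -/
def minTensorIncl (E : Submodule ℂ (H →L[ℂ] H)) (F : Submodule ℂ (K →L[ℂ] K)) :
    MinTensor E F →ₗᵢ[ℂ] (HilbertTensor H K →L[ℂ] HilbertTensor H K) :=
  (minTensorSubmodule E F).subtypeₗᵢ

/-- The elementary tensor `x ⊗ y` in the minimal tensor product. -/
def minTmul {E : Submodule ℂ (H →L[ℂ] H)} {F : Submodule ℂ (K →L[ℂ] K)} (x : E) (y : F) :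
    MinTensor E F :=
  show minTensorSubmodule E F from
    ⟨opTensor (x : H →L[ℂ] H) (y : K →L[ℂ] K),
      Submodule.le_topologicalClosure _ (Submodule.subset_span ⟨x, x.2, y, y.2, rfl⟩)⟩

theorem minTensorIncl_minTmul {E : Submodule ℂ (H →L[ℂ] H)} {F : Submodule ℂ (K →L[ℂ] K)}
    (x : E) (y : F) :
    minTensorIncl E F (minTmul x y) = opTensor (x : H →L[ℂ] H) (y : K →L[ℂ] K) := rfl

end MinTensor

/-! ### `(2,oh)`-summing operators -/

section Summing

variable {H : Type*} [NormedAddCommGroup H] [InnerProductSpace ℂ H]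
  {F : Type*} [NormedAddCommGroup F] [NormedSpace ℂ F]

/-- `C ≥ 0` satisfies `(∑ ‖u xᵢ‖²)^{1/2} ≤ C ‖∑ xᵢ ⊗ conj xᵢ‖^{1/2}`, with the norm of the minimal
tensor product of `E` and its conjugate, for all finite sequences `(xᵢ)` in `E`. -/
def IsTwoOHConstant {E : Submodule ℂ (H →L[ℂ] H)} (u : E →L[ℂ] F) (C : ℝ) : Prop :=
  0 ≤ C ∧ ∀ (n : ℕ) (x : Fin n → E),
    Real.sqrt (∑ i, ‖u (x i)‖ ^ 2) ≤ C * Real.sqrt ‖∑ i, minTmul (x i) (conjElt (x i))‖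

/-- `u` is `(2,oh)`-summing. -/
def IsTwoOHSumming {E : Submodule ℂ (H →L[ℂ] H)} (u : E →L[ℂ] F) : Prop :=
  ∃ C : ℝ, IsTwoOHConstant u C

/-- The `(2,oh)`-summing norm of `u` (meaningful when `u` is `(2,oh)`-summing): the least
admissible constant. -/
def piTwoOH {E : Submodule ℂ (H →L[ℂ] H)} (u : E →L[ℂ] F) : ℝ :=
  sInf {C : ℝ | IsTwoOHConstant u C}

end Summing

end

/-!
The condition with `v` gives the summing inequality by adding up `‖u xᵢ‖² ≤ v (xᵢ ⊗ conj xᵢ)` and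
using `‖v‖ ≤ 1`.

For the converse, the infimum defining `piTwoOH u` is attained, so `∑ ‖u xᵢ‖² ≤ ‖∑ xᵢ ⊗ conj xᵢ‖`
for all finite families. The pairs `(∑ xᵢ ⊗ conj xᵢ, ∑ ‖u xᵢ‖²)` form a convex cone `K`
(`twoOHCone`) on which the second coordinate is at most the norm of the first. Then
`N s = inf {‖s + c‖ - q | (c, q) ∈ K}` is a finite sublinear functional with `-‖s‖ ≤ N s ≤ ‖s‖`, and a
real linear functional dominated by `N`, which exists by the Hahn–Banach theorem, has norm at most
`1` and is at least `q` at `c` for every `(c, q) ∈ K` (`exists_dual_ge_of_convexCone`). It is the real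
part of a complex linear functional `w` of the same norm.

It remains to make the values at `x ⊗ conj x` real. The antiunitary `h ⊗ conj k ↦ k ⊗ conj h` of the
Hilbert space tensor product (`tensorFlip`) induces, by conjugation of operators, an antilinear
contraction `T ↦ T'` fixing every `x ⊗ conj x`. The functional `T ↦ (w T + conj (w T')) / 2` is
linear, has norm at most `1`, and its value at `x ⊗ conj x` is the real part of that of `w`. All
functionals are built on the bounded operators on the whole Hilbert space tensor product and
restricted to the minimal tensor product at the end.
-/

open scoped TensorProduct InnerProductSpace ComplexConjugate

noncomputable section

/-! ### A functional dominated by the norm and bounded below on a cone -/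

/-- The sublinear functional behind the proof is `s ↦ inf {‖s + c‖ - q | (c, q) ∈ K}`. -/
theorem exists_dual_ge_of_convexCone {X : Type*} [NormedAddCommGroup X] [NormedSpace ℝ X]
    (K : ConvexCone ℝ (X × ℝ)) (h0 : (0 : X × ℝ) ∈ K) (hK : ∀ z ∈ K, z.2 ≤ ‖z.1‖) :
    ∃ f : X →L[ℝ] ℝ, ‖f‖ ≤ 1 ∧ ∀ z ∈ K, z.2 ≤ f z.1 := by
  have : Nonempty K := ⟨⟨0, h0⟩⟩
  let N : X → ℝ := fun s => ⨅ z : K, (‖s + z.1.1‖ - z.1.2)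
  have hbdd : ∀ s, BddBelow (Set.range fun z : K => ‖s + z.1.1‖ - z.1.2) := by
    intro s
    refine ⟨-‖s‖, ?_⟩
    rintro _ ⟨z, rfl⟩
    have h1 := hK z.1 z.2
    have h2 : ‖z.1.1‖ ≤ ‖s + z.1.1‖ + ‖s‖ := by
      simpa using norm_sub_le (s + z.1.1) s
    dsimp only
    linarith
  have hN_le : ∀ s (z : X × ℝ), z ∈ K → N s ≤ ‖s + z.1‖ - z.2 := fun s z hz =>
    ciInf_le (hbdd s) (⟨z, hz⟩ : K)
  have hN_smul_le : ∀ c : ℝ, 0 < c → ∀ s, N (c • s) ≤ c * N s := by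
    intro c hc s
    rw [mul_comm, ← div_le_iff₀ hc]
    refine le_ciInf fun z => ?_
    rw [div_le_iff₀ hc]
    have h := hN_le (c • s) (c • z.1) (K.smul_mem hc z.2)
    rw [Prod.smul_fst, Prod.smul_snd, ← smul_add, norm_smul, Real.norm_of_nonneg hc.le,
      smul_eq_mul] at h
    linarith
  have hN_smul : ∀ c : ℝ, 0 < c → ∀ s, N (c • s) = c * N s := by
    intro c hc s
    refine le_antisymm (hN_smul_le c hc s) ?_
    have h := hN_smul_le c⁻¹ (inv_pos.2 hc) (c • s)
    rw [inv_smul_smul₀ hc.ne'] at h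
    calc c * N s ≤ c * (c⁻¹ * N (c • s)) := by gcongr
      _ = N (c • s) := by rw [mul_inv_cancel_left₀ hc.ne']
  have hN_add : ∀ s t, N (s + t) ≤ N s + N t := by
    intro s t
    rw [← sub_le_iff_le_add]
    refine le_ciInf fun z => ?_
    rw [sub_le_comm]
    refine le_ciInf fun y => ?_
    have h := hN_le (s + t) (z.1 + y.1) (K.add_mem z.2 y.2)
    have h2 : ‖s + t + (z.1 + y.1).1‖ ≤ ‖s + z.1.1‖ + ‖t + y.1.1‖ := by
      rw [Prod.fst_add, add_add_add_comm]
      exact norm_add_le _ _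
    rw [Prod.snd_add] at h
    linarith
  have hN_norm : ∀ s, N s ≤ ‖s‖ := fun s => by simpa using hN_le s 0 h0
  have hN_zero : 0 ≤ N 0 := by
    refine le_ciInf fun z => ?_
    simpa using hK z.1 z.2
  obtain ⟨g, -, hg⟩ := exists_extension_of_le_sublinear (⊥ : X →ₗ.[ℝ] ℝ) N hN_smul hN_add
    (by
      rintro ⟨x, hx⟩
      obtain rfl : x = 0 := (Submodule.mem_bot ℝ).1 hx
      exact hN_zero)
  have hg_norm : ∀ s, ‖g s‖ ≤ 1 * ‖s‖ := by
    intro s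
    rw [one_mul, Real.norm_eq_abs, abs_le']
    refine ⟨(hg s).trans (hN_norm s), ?_⟩
    rw [← map_neg, ← norm_neg s]
    exact (hg _).trans (hN_norm _)
  refine ⟨g.mkContinuous 1 hg_norm, g.mkContinuous_norm_le zero_le_one _, fun z hz => ?_⟩
  have h := (hg (-z.1)).trans (hN_le (-z.1) z hz)
  rw [neg_add_cancel, norm_zero, map_neg] at h
  simpa using h

/-! ### The antiunitary flip of the tensor product with the conjugate space -/

section Flip

variable {H : Type*} [NormedAddCommGroup H] [InnerProductSpace ℂ H]

/-- The antilinear map `h ⊗ conj k ↦ k ⊗ conj h` on the algebraic tensor product. -/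
def algTensorFlip (H : Type*) [NormedAddCommGroup H] [InnerProductSpace ℂ H] :
    H ⊗[ℂ] ConjSpace H →ₗ⋆[ℂ] H ⊗[ℂ] ConjSpace H :=
  (TensorProduct.map (ConjSpace.mk (H := H)).symm.toLinearEquiv.toLinearMap
    (ConjSpace.mk (H := H)).toLinearEquiv.toLinearMap).comp
    (TensorProduct.comm ℂ H (ConjSpace H)).toLinearMap

theorem algTensorFlip_tmul (h : H) (k : ConjSpace H) :
    algTensorFlip H (h ⊗ₜ[ℂ] k) = ConjSpace.mk.symm k ⊗ₜ[ℂ] ConjSpace.mk h := rfl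

theorem inner_algTensorFlip (s t : H ⊗[ℂ] ConjSpace H) :
    ⟪algTensorFlip H s, algTensorFlip H t⟫_ℂ = ⟪t, s⟫_ℂ := by
  induction s with
  | zero => simp
  | add a b ha hb => rw [map_add, inner_add_left, inner_add_right, ha, hb]
  | tmul h k =>
    induction t with
    | zero => simp
    | add a b ha hb => rw [map_add, inner_add_left, inner_add_right, ha, hb]
    | tmul h' k' =>
      rw [algTensorFlip_tmul, algTensorFlip_tmul, TensorProduct.inner_tmul,
        TensorProduct.inner_tmul, mul_comm]
      rfl

theorem norm_algTensorFlip (t : H ⊗[ℂ] ConjSpace H) : ‖algTensorFlip H t‖ = ‖t‖ := by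
  rw [norm_eq_sqrt_re_inner (𝕜 := ℂ), inner_algTensorFlip]
  exact (norm_eq_sqrt_re_inner (𝕜 := ℂ) t).symm

/-- The antiunitary `h ⊗ conj k ↦ k ⊗ conj h` of the Hilbert space tensor product. -/
def tensorFlip (H : Type*) [NormedAddCommGroup H] [InnerProductSpace ℂ H] :
    HilbertTensor H (ConjSpace H) →L⋆[ℂ] HilbertTensor H (ConjSpace H) :=
  ((HilbertTensor.incl H (ConjSpace H)).toLinearMap.comp (algTensorFlip H)).extendOfNorm
    (HilbertTensor.incl H (ConjSpace H)).toLinearMap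

theorem norm_incl_algTensorFlip_le (t : H ⊗[ℂ] ConjSpace H) :
    ‖((HilbertTensor.incl H (ConjSpace H)).toLinearMap.comp (algTensorFlip H)) t‖ ≤
      1 * ‖(HilbertTensor.incl H (ConjSpace H)).toLinearMap t‖ := by
  rw [LinearMap.comp_apply, LinearIsometry.coe_toLinearMap, LinearIsometry.norm_map,
    LinearIsometry.norm_map, norm_algTensorFlip, one_mul]

theorem tensorFlip_incl (t : H ⊗[ℂ] ConjSpace H) :
    tensorFlip H (HilbertTensor.incl H (ConjSpace H) t) =
      HilbertTensor.incl H (ConjSpace H) (algTensorFlip H t) :=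
  LinearMap.extendOfNorm_eq HilbertTensor.denseRange_incl ⟨1, norm_incl_algTensorFlip_le⟩ t

theorem norm_tensorFlip_le : ‖tensorFlip H‖ ≤ 1 :=
  LinearMap.opNorm_extendOfNorm_le HilbertTensor.denseRange_incl zero_le_one
    norm_incl_algTensorFlip_le

theorem HilbertTensor.ext_clm {H K G : Type*} [NormedAddCommGroup H] [InnerProductSpace ℂ H]
    [NormedAddCommGroup K] [InnerProductSpace ℂ K] [NormedAddCommGroup G] [NormedSpace ℂ G]
    {S T : HilbertTensor H K →L[ℂ] G}
    (h : ∀ (a : H) (b : K), S (incl H K (a ⊗ₜ[ℂ] b)) = T (incl H K (a ⊗ₜ[ℂ] b))) : S = T := by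
  refine DFunLike.coe_injective (denseRange_incl.equalizer S.continuous T.continuous ?_)
  funext t
  simp only [Function.comp_apply]
  induction t with
  | zero => simp
  | add a b ha hb => rw [map_add, map_add, map_add, ha, hb]
  | tmul a b => exact h a b

theorem tensorFlip_comp_opTensor_conjOp (x : H →L[ℂ] H) :
    (tensorFlip H).comp ((opTensor x (conjOp x)).comp (tensorFlip H)) = opTensor x (conjOp x) := by
  refine HilbertTensor.ext_clm fun h k => ?_
  rw [ContinuousLinearMap.comp_apply, ContinuousLinearMap.comp_apply, tensorFlip_incl,
    algTensorFlip_tmul, opTensor_incl_tmul, tensorFlip_incl, algTensorFlip_tmul,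
    opTensor_incl_tmul]
  rfl

theorem opTensor_smul_conjOp_smul (r : ℝ) (x : H →L[ℂ] H) :
    opTensor ((r : ℂ) • x) (conjOp ((r : ℂ) • x)) = (r ^ 2) • opTensor x (conjOp x) := by
  refine HilbertTensor.ext_clm fun h k => ?_
  rw [smul_apply, opTensor_incl_tmul, opTensor_incl_tmul, map_smulₛₗ,
    Complex.conj_ofReal, smul_apply, smul_apply,
    TensorProduct.smul_tmul_smul, map_smul, ← Complex.ofReal_mul, ← sq, Complex.coe_smul]

/-- The mean of `w` and its conjugate by the flip: a functional that is real on every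
`x ⊗ conj x`. -/
theorem exists_dual_eq_re (w : (HilbertTensor H (ConjSpace H) →L[ℂ]
      HilbertTensor H (ConjSpace H)) →L[ℂ] ℂ) (hw : ‖w‖ ≤ 1) :
    ∃ v : (HilbertTensor H (ConjSpace H) →L[ℂ] HilbertTensor H (ConjSpace H)) →L[ℂ] ℂ,
      ‖v‖ ≤ 1 ∧ ∀ x : H →L[ℂ] H,
        v (opTensor x (conjOp x)) = ((w (opTensor x (conjOp x))).re : ℂ) := by
  let J (T : HilbertTensor H (ConjSpace H) →L[ℂ] HilbertTensor H (ConjSpace H)) :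
      HilbertTensor H (ConjSpace H) →L[ℂ] HilbertTensor H (ConjSpace H) :=
    (tensorFlip H).comp (T.comp (tensorFlip H))
  have hJ_add : ∀ S T, J (S + T) = J S + J T := by
    intro S T
    ext t
    simp [J]
  have hJ_smul : ∀ (c : ℂ) T, J (c • T) = conj c • J T := by
    intro c T
    ext t
    simp [J]
  have hF : ∀ t, ‖tensorFlip H t‖ ≤ ‖t‖ := fun t => by
    simpa using (tensorFlip H).le_of_opNorm_le norm_tensorFlip_le t
  have hJ_norm : ∀ T, ‖J T‖ ≤ ‖T‖ := by
    intro T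
    refine ContinuousLinearMap.opNorm_le_bound _ (norm_nonneg _) fun t => ?_
    calc ‖J T t‖ ≤ ‖T (tensorFlip H t)‖ := hF _
      _ ≤ ‖T‖ * ‖tensorFlip H t‖ := T.le_opNorm _
      _ ≤ ‖T‖ * ‖t‖ := by gcongr; exact hF t
  have hw' : ∀ T, ‖w T‖ ≤ ‖T‖ := fun T => by simpa using w.le_of_opNorm_le hw T
  let v₀ : (HilbertTensor H (ConjSpace H) →L[ℂ] HilbertTensor H (ConjSpace H)) →ₗ[ℂ] ℂ :=
    { toFun := fun T => (w T + conj (w (J T))) / 2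
      map_add' := fun S T => by
        rw [hJ_add, map_add, map_add, map_add]
        ring
      map_smul' := fun c T => by
        rw [hJ_smul, map_smul, map_smul, smul_eq_mul, smul_eq_mul, map_mul, Complex.conj_conj,
          RingHom.id_apply, smul_eq_mul]
        ring }
  have hv : ∀ T, ‖v₀ T‖ ≤ 1 * ‖T‖ := by
    intro T
    have h1 : ‖w T + conj (w (J T))‖ ≤ ‖T‖ + ‖T‖ := by
      refine (norm_add_le _ _).trans (add_le_add (hw' T) ?_)
      rw [RCLike.norm_conj]
      exact (hw' _).trans (hJ_norm T)
    change ‖(w T + conj (w (J T))) / 2‖ ≤ 1 * ‖T‖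
    rw [norm_div, Complex.norm_two]
    linarith
  refine ⟨v₀.mkContinuous 1 hv, v₀.mkContinuous_norm_le zero_le_one _, fun x => ?_⟩
  have hx : J (opTensor x (conjOp x)) = opTensor x (conjOp x) := tensorFlip_comp_opTensor_conjOp x
  change (w (opTensor x (conjOp x)) + conj (w (J (opTensor x (conjOp x))))) / 2 = _
  rw [hx, Complex.add_conj]
  push_cast
  ring

end Flip

/-! ### The summing inequality -/

section Summing

variable {H : Type*} [NormedAddCommGroup H] [InnerProductSpace ℂ H]
  {F : Type*} [NormedAddCommGroup F] [NormedSpace ℂ F] {E : Submodule ℂ (H →L[ℂ] H)}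

theorem minTensorIncl_sum_minTmul_conjElt {n : ℕ} (x : Fin n → E) :
    minTensorIncl E (conjOpSpace E) (∑ i, minTmul (x i) (conjElt (x i))) =
      ∑ i, opTensor (x i : H →L[ℂ] H) (conjOp (x i : H →L[ℂ] H)) :=
  map_sum _ _ _

theorem norm_sum_minTmul_conjElt {n : ℕ} (x : Fin n → E) :
    ‖∑ i, minTmul (x i) (conjElt (x i))‖ =
      ‖∑ i, opTensor (x i : H →L[ℂ] H) (conjOp (x i : H →L[ℂ] H))‖ := by
  rw [← minTensorIncl_sum_minTmul_conjElt, LinearIsometry.norm_map]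

/-- The infimum of the admissible constants is attained: these constants form a closed set. -/
theorem isTwoOHConstant_one {u : E →L[ℂ] F} (hu : IsTwoOHSumming u) (hpi : piTwoOH u ≤ 1) :
    IsTwoOHConstant u 1 := by
  refine ⟨zero_le_one, fun n x => ?_⟩
  have key : ∀ C, 1 < C → Real.sqrt (∑ i, ‖u (x i)‖ ^ 2) ≤
      C * Real.sqrt ‖∑ i, minTmul (x i) (conjElt (x i))‖ := by
    intro C hC
    obtain ⟨D, hD, hDC⟩ := exists_lt_of_csInf_lt hu (hpi.trans_lt hC)
    refine (hD.2 n x).trans ?_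
    gcongr
  exact ge_of_tendsto (x := nhdsWithin (1 : ℝ) (Set.Ioi 1))
    (((continuous_id.mul continuous_const).tendsto 1).mono_left nhdsWithin_le_nhds)
    (Filter.eventually_of_mem self_mem_nhdsWithin key)

/-- The convex cone of the pairs `(∑ xᵢ ⊗ conj xᵢ, ∑ ‖u xᵢ‖²)`, over all finite families in `E`. -/
def twoOHCone (u : E →L[ℂ] F) :
    ConvexCone ℝ ((HilbertTensor H (ConjSpace H) →L[ℂ] HilbertTensor H (ConjSpace H)) × ℝ) where
  carrier := {z | ∃ (n : ℕ) (x : Fin n → E),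
    z = (∑ i, opTensor (x i : H →L[ℂ] H) (conjOp (x i : H →L[ℂ] H)), ∑ i, ‖u (x i)‖ ^ 2)}
  smul_mem' := by
    rintro c hc _ ⟨n, x, rfl⟩
    refine ⟨n, fun i => (Real.sqrt c : ℂ) • x i, ?_⟩
    simp only [Submodule.coe_smul, opTensor_smul_conjOp_smul, Real.sq_sqrt hc.le, map_smul,
      norm_smul, mul_pow, Complex.norm_real, Real.norm_eq_abs, sq_abs, ← Finset.smul_sum,
      ← Finset.mul_sum]
    rfl
  add_mem' := by
    rintro _ ⟨n, x, rfl⟩ _ ⟨m, y, rfl⟩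
    refine ⟨n + m, Fin.append x y, ?_⟩
    simp [Fin.sum_univ_add]

theorem zero_mem_twoOHCone (u : E →L[ℂ] F) : 0 ∈ twoOHCone u :=
  ⟨0, Fin.elim0, by simp only [Fin.sum_univ_zero]; rfl⟩

theorem opTensor_mem_twoOHCone (u : E →L[ℂ] F) (x : E) :
    (opTensor (x : H →L[ℂ] H) (conjOp (x : H →L[ℂ] H)), ‖u x‖ ^ 2) ∈ twoOHCone u :=
  ⟨1, fun _ => x, by simp⟩

theorem le_norm_of_mem_twoOHCone {u : E →L[ℂ] F} (hu : IsTwoOHConstant u 1) :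
    ∀ z ∈ twoOHCone u, z.2 ≤ ‖z.1‖ := by
  rintro _ ⟨n, x, rfl⟩
  have h := hu.2 n x
  rwa [one_mul, norm_sum_minTmul_conjElt, Real.sqrt_le_sqrt_iff (norm_nonneg _)] at h

theorem isTwoOHConstant_one_of_dual {u : E →L[ℂ] F} {v : MinTensor E (conjOpSpace E) →L[ℂ] ℂ}
    (hv : ‖v‖ ≤ 1) (h : ∀ x : E, ‖u x‖ ^ 2 ≤ (v (minTmul x (conjElt x))).re) :
    IsTwoOHConstant u 1 := by
  refine ⟨zero_le_one, fun n x => ?_⟩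
  rw [one_mul]
  refine Real.sqrt_le_sqrt ?_
  calc ∑ i, ‖u (x i)‖ ^ 2 ≤ ∑ i, (v (minTmul (x i) (conjElt (x i)))).re :=
        Finset.sum_le_sum fun i _ => h (x i)
    _ = (v (∑ i, minTmul (x i) (conjElt (x i)))).re := by rw [map_sum, Complex.re_sum]
    _ ≤ ‖v (∑ i, minTmul (x i) (conjElt (x i)))‖ := Complex.re_le_norm _
    _ ≤ ‖∑ i, minTmul (x i) (conjElt (x i))‖ := by
        rw [← one_mul ‖∑ i, minTmul (x i) (conjElt (x i))‖]
        exact v.le_of_opNorm_le hv _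

theorem exists_dual_of_isTwoOHConstant_one {u : E →L[ℂ] F} (hu : IsTwoOHConstant u 1) :
    ∃ v : MinTensor E (conjOpSpace E) →L[ℂ] ℂ, ‖v‖ ≤ 1 ∧
      ∀ x : E, (v (minTmul x (conjElt x))).im = 0 ∧
        ‖u x‖ ^ 2 ≤ (v (minTmul x (conjElt x))).re := by
  obtain ⟨f, hf, hfu⟩ := exists_dual_ge_of_convexCone (twoOHCone u) (zero_mem_twoOHCone u)
    (le_norm_of_mem_twoOHCone hu)
  obtain ⟨v, hv, hvw⟩ := exists_dual_eq_re (StrongDual.extendRCLike (𝕜 := ℂ) f)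
    (by rw [StrongDual.norm_extendRCLike]; exact hf)
  refine ⟨v.comp (minTensorIncl E (conjOpSpace E)).toContinuousLinearMap, ?_, fun x => ?_⟩
  · refine ContinuousLinearMap.opNorm_le_bound _ zero_le_one fun t => ?_
    simpa using v.le_of_opNorm_le hv (minTensorIncl E (conjOpSpace E) t)
  · have h : (v.comp (minTensorIncl E (conjOpSpace E)).toContinuousLinearMap)
        (minTmul x (conjElt x)) = (f (opTensor (x : H →L[ℂ] H) (conjOp (x : H →L[ℂ] H))) : ℂ) := by
      have h := hvw (x : H →L[ℂ] H)
      rw [← RCLike.re_eq_complex_re, StrongDual.re_extendRCLike_apply] at h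
      exact h
    rw [h]
    exact ⟨Complex.ofReal_im _, hfu _ (opTensor_mem_twoOHCone u x)⟩

end Summing

end

theorem proposition3 {H : Type*} [NormedAddCommGroup H] [InnerProductSpace ℂ H] [CompleteSpace H]
    (E : Submodule ℂ (H →L[ℂ] H)) (hE : IsClosed (E : Set (H →L[ℂ] H)))
    (u : E →L[ℂ] lp (fun _ : ℕ => ℂ) 2) :
    (IsTwoOHSumming u ∧ piTwoOH u ≤ 1) ↔
      ∃ v : MinTensor E (conjOpSpace E) →L[ℂ] ℂ, ‖v‖ ≤ 1 ∧
        ∀ x : E, (v (minTmul x (conjElt x))).im = 0 ∧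
          ‖u x‖ ^ 2 ≤ (v (minTmul x (conjElt x))).re := by
  refine ⟨fun h => exists_dual_of_isTwoOHConstant_one (isTwoOHConstant_one h.1 h.2), ?_⟩
  rintro ⟨v, hv, h⟩
  have h1 := isTwoOHConstant_one_of_dual hv fun x => (h x).2
  exact ⟨⟨1, h1⟩, csInf_le ⟨0, fun _ hC => hC.1⟩ h1⟩
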